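/- For $u\in L^2(0,1)$ (real-valued) let $$|u|_{TV}=\sup\Big\{\int_0^1 u\,\varphi'\,dx:\ \varphi\in C_c^\infty((0,1)),\ \|\varphi\|_\infty\le 1\Big\}\in[0,\infty].$$ For $\lambda>0$ and $f\in L^2(0,1)$ consider the TV-denoising (ROF/Tikhonov) functional $$F_{\lambda,f}(u)=\frac{\lambda}{2}\|u-f\|_{L^2(0,1)}^2+|u|_{TV},\qquad u\in L^2(0,1).$$ Let $y\in L^2(0,1)$ and let $(\lambda_n)_{n\in\mathbb N_0}$ be a (not necessarily strictly) increasing sequence of positive real numbers. The multiscale hierarchical decomposition method (MHDM) with data $y$ computes $$u_0\in\operatorname{argmin}F_{\lambda_0,y},\qquad x_0=u_0,\qquad u_n\in\operatorname{argmin}F_{\lambda_n,\,y-x_{n-1}},\qquad x_n=x_{n-1}+u_n\quad(n\ge 1).$$ Then for every $n\in\mathbb N_0$ the functional $F_{\lambda_n,y}$ has exactly one minimizer $x_{\lambda_n}$ in $L^2(0,1)$, the MHDM sequence $(u_n)_{n\in\mathbb N_0}$ exists and is unique, and the MHDM iterates agree with the Tikhonov minimizers: $$x_n=x_{\lambda_n}\qquad\text{for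 all } n\in\mathbb N_0 .$$ -/

import Mathlib

open MeasureTheory Set
open scoped ENNReal ContDiff

noncomputable section

namespace MHDM

section General

variable {X H : Type*} [NormedAddCommGroup X] [NormedSpace ℝ X]
  [NormedAddCommGroup H] [InnerProductSpace ℝ H]

/-- The generalized Tikhonov functional `F_l(u) = (l/2) ‖T u - f‖² + J(u)`, with values in `[0, ∞]`
(used for `l > 0`). -/
def tikhonov (T : X →L[ℝ] H) (J : X → ℝ≥0∞) (l : ℝ) (f : H) (u : X) : ℝ≥0∞ :=
  ENNReal.ofReal (l / 2 * ‖T u - f‖ ^ 2) + J u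

/-- `u` is a minimizer over `X` of the Tikhonov functional with parameter `l` and data `f`. -/
def IsTikhonovMinimizer (T : X →L[ℝ] H) (J : X → ℝ≥0∞) (l : ℝ) (f : H) (u : X) : Prop :=
  ∀ w : X, tikhonov T J l f u ≤ tikhonov T J l f w

/-- The iterate `x_n = u_0 + … + u_n` formed from the components `u_0, u_1, …`. -/
def iterate (u : ℕ → X) (n : ℕ) : X := ∑ i ∈ Finset.range (n + 1), u i

/-- `u_0, u_1, …` are components produced by the multiscale hierarchical decomposition method with
operator `T`, penalty `J`, parameters `lam n` and data `f`: `u_0` minimizes the Tikhonov functional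
with data `f` and parameter `lam 0`, and `u_{n+1}` minimizes the one whose data is the residual
`v_n = f - T x_n` and whose parameter is `lam (n + 1)`. -/
structure IsDecomposition (T : X →L[ℝ] H) (J : X → ℝ≥0∞) (lam : ℕ → ℝ) (f : H) (u : ℕ → X) :
    Prop where
  zero : IsTikhonovMinimizer T J (lam 0) f (u 0)
  succ : ∀ n : ℕ, IsTikhonovMinimizer T J (lam (n + 1)) (f - T (iterate u n)) (u (n + 1))

end General

/-- Real `L²` on the unit interval `(0, 1)` with Lebesgue measure. -/
abbrev L2 : Type := Lp ℝ 2 (volume.restrict (Ioo (0 : ℝ) 1))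

/-- Admissible test functions for the total variation on `(0, 1)`: smooth functions with compact
support in `(0, 1)` and sup norm at most one. -/
def IsTestFunction (φ : ℝ → ℝ) : Prop :=
  ContDiff ℝ ∞ φ ∧ HasCompactSupport φ ∧ tsupport φ ⊆ Ioo (0 : ℝ) 1 ∧ ∀ x, |φ x| ≤ 1

/-- The total variation seminorm `|u|_TV = sup { ∫ u φ' }` on `L²(0, 1)`, with value `∞` if `u` is
not of bounded variation. Cutting the integrals off at zero does not change the supremum, because
`φ = 0` is admissible. -/
def totalVariation (u : L2) : ℝ≥0∞ :=
  ⨆ φ : {φ : ℝ → ℝ // IsTestFunction φ},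
    ENNReal.ofReal (∫ x in Ioo (0 : ℝ) 1, u x * deriv φ.1 x)

end MHDM

end

/-!
The total variation is the support function of the closed convex set `K` of derivatives of functions
that are bounded by one and vanish at both endpoints. By Fenchel duality, the Tikhonov minimizer
with parameter `l` and data `f` is `f - a`, where `a` is the metric projection of `f` onto
`l⁻¹ • K`. So the claim is a tower property of projections: for `0 < s ≤ t`, projecting onto `t • K`
and then onto `s • K` amounts to projecting onto `s • K`.

Let `b` be the projection of `y` onto `t • K` and `a` that of `b` onto `s • K`. If the residual
`b - a` lies in `(t - s) • K`, then `p + (b - a) ∈ t • K` for every `p ∈ s • K`, and adding the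
variational inequality of `b` at this point to that of `a` at `p` gives the variational inequality
for `a` as the projection of `y`. To see that `b - a ∈ (t - s) • K`, clip the primitive of `b - a`
to `[-(t - s), t - s]`. The derivative `q` of the clipped function agrees with `b - a` wherever it
is not zero, so `⟪b - a - q, q⟫ = 0`, while `b - q ∈ s • K`. The variational inequality of `a` at
`b - q` now gives `‖b - a - q‖² ≤ 0`.
-/

namespace MHDM

open scoped RealInnerProductSpace Pointwise

section Projection

variable {H : Type*} [NormedAddCommGroup H] [InnerProductSpace ℝ H] {K : Set H} {f a b : H}

/-- `a` is the metric projection of `f` onto the convex set `K`, expressed by the variational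
inequality. -/
def IsProjection (K : Set H) (f a : H) : Prop :=
  a ∈ K ∧ ∀ p ∈ K, ⟪f - a, p - a⟫ ≤ 0

theorem exists_isProjection [CompleteSpace H] (hne : K.Nonempty) (hcl : IsClosed K)
    (hconv : Convex ℝ K) (f : H) : ∃ a, IsProjection K f a := by
  obtain ⟨a, ha, hmin⟩ := exists_norm_eq_iInf_of_complete_convex hne hcl.isComplete hconv f
  exact ⟨a, ha, (norm_eq_iInf_iff_real_inner_le_zero hconv ha).1 hmin⟩

theorem IsProjection.eq (ha : IsProjection K f a) (hb : IsProjection K f b) : a = b := by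
  have hab : ⟪a - b, a - b⟫ = ⟪f - a, b - a⟫ + ⟪f - b, a - b⟫ := by
    rw [← neg_sub a b, inner_neg_right, neg_add_eq_sub, ← inner_sub_left, sub_sub_sub_cancel_left]
  have hle : ⟪a - b, a - b⟫ ≤ 0 := hab.trans_le (add_nonpos (ha.2 b hb.1) (hb.2 a ha.1))
  exact sub_eq_zero.1 (real_inner_self_nonpos.1 hle)

theorem isProjection_self (ha : a ∈ K) : IsProjection K a a :=
  ⟨ha, fun p _ => by rw [sub_self, inner_zero_left]⟩

end Projection

section SupportFunction

variable {H : Type*} [NormedAddCommGroup H] [InnerProductSpace ℝ H] {K : Set H} {f a u : H} {l : ℝ}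

/-- The support function `u ↦ sup { ⟪p, u⟫ | p ∈ K }` of `K`, cut off at zero. The cut-off has no
effect when `0 ∈ K`. -/
noncomputable def supportFunction (K : Set H) (u : H) : ℝ≥0∞ :=
  ⨆ p ∈ K, ENNReal.ofReal ⟪p, u⟫

theorem ofReal_inner_le_supportFunction {p : H} (hp : p ∈ K) (u : H) :
    ENNReal.ofReal ⟪p, u⟫ ≤ supportFunction K u :=
  le_iSup₂ (f := fun p (_ : p ∈ K) => ENNReal.ofReal ⟪p, u⟫) p hp

theorem supportFunction_closure (K : Set H) : supportFunction (closure K) = supportFunction K := by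
  funext u
  have hclosed : IsClosed {p : H | ENNReal.ofReal ⟪p, u⟫ ≤ supportFunction K u} :=
    isClosed_le (ENNReal.continuous_ofReal.comp (continuous_id.inner continuous_const))
      continuous_const
  refine le_antisymm (iSup₂_le fun p hp => ?_) (biSup_mono fun p hp => subset_closure hp)
  exact closure_minimal (fun q hq => ofReal_inner_le_supportFunction hq u) hclosed hp

theorem IsProjection.inner_residual_le (hl : 0 < l) (ha : IsProjection (l⁻¹ • K) f a) {p : H}
    (hp : p ∈ K) : ⟪p, f - a⟫ ≤ ⟪l • a, f - a⟫ := by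
  have h := ha.2 (l⁻¹ • p) (smul_mem_smul_set hp)
  rw [real_inner_comm, inner_sub_left, real_inner_smul_left, sub_nonpos, inv_mul_le_iff₀ hl] at h
  rwa [real_inner_smul_left]

theorem IsProjection.smul_mem (hl : 0 < l) (ha : IsProjection (l⁻¹ • K) f a) : l • a ∈ K :=
  (mem_inv_smul_set_iff₀ hl.ne' K a).1 ha.1

theorem IsProjection.supportFunction_residual (hl : 0 < l) (ha : IsProjection (l⁻¹ • K) f a) :
    supportFunction K (f - a) = ENNReal.ofReal ⟪l • a, f - a⟫ :=
  le_antisymm (iSup₂_le fun _ hp => ENNReal.ofReal_le_ofReal (ha.inner_residual_le hl hp))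
    (ofReal_inner_le_supportFunction (ha.smul_mem hl) _)

theorem IsProjection.tikhonov_residual_add_le (hl : 0 < l) (h0 : 0 ∈ K)
    (ha : IsProjection (l⁻¹ • K) f a) (w : H) :
    tikhonov (ContinuousLinearMap.id ℝ H) (supportFunction K) l f (f - a) +
        ENNReal.ofReal (l / 2 * ‖w - (f - a)‖ ^ 2) ≤
      tikhonov (ContinuousLinearMap.id ℝ H) (supportFunction K) l f w := by
  have hnonneg : 0 ≤ ⟪l • a, f - a⟫ := by simpa using ha.inner_residual_le hl h0
  have hsplit : l / 2 * ‖f - a - f‖ ^ 2 + ⟪l • a, f - a⟫ + l / 2 * ‖w - (f - a)‖ ^ 2 =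
      l / 2 * ‖w - f‖ ^ 2 + ⟪l • a, w⟫ := by
    have hw : w - (f - a) = (w - f) + a := by abel
    have hfa : f - a = w - ((w - f) + a) := by abel
    rw [sub_sub_cancel_left, norm_neg, hw, norm_add_sq_real, hfa, real_inner_smul_left,
      real_inner_smul_left, inner_sub_right, inner_add_right, real_inner_self_eq_norm_sq,
      real_inner_comm a (w - f)]
    ring
  calc tikhonov (ContinuousLinearMap.id ℝ H) (supportFunction K) l f (f - a) +
        ENNReal.ofReal (l / 2 * ‖w - (f - a)‖ ^ 2)
    _ = ENNReal.ofReal (l / 2 * ‖w - f‖ ^ 2 + ⟪l • a, w⟫) := by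
      rw [tikhonov, ha.supportFunction_residual hl, ContinuousLinearMap.id_apply, ← hsplit,
        ENNReal.ofReal_add (by positivity) (by positivity),
        ENNReal.ofReal_add (by positivity) hnonneg]
    _ ≤ ENNReal.ofReal (l / 2 * ‖w - f‖ ^ 2) + ENNReal.ofReal ⟪l • a, w⟫ := ENNReal.ofReal_add_le
    _ ≤ tikhonov (ContinuousLinearMap.id ℝ H) (supportFunction K) l f w := by
      rw [tikhonov, ContinuousLinearMap.id_apply]
      gcongr
      exact ofReal_inner_le_supportFunction (ha.smul_mem hl) w

theorem IsProjection.isTikhonovMinimizer_iff (hl : 0 < l) (h0 : 0 ∈ K)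
    (ha : IsProjection (l⁻¹ • K) f a) :
    IsTikhonovMinimizer (ContinuousLinearMap.id ℝ H) (supportFunction K) l f u ↔ u = f - a := by
  have hgrowth := ha.tikhonov_residual_add_le hl h0
  constructor
  · intro hu
    have hfinite : tikhonov (ContinuousLinearMap.id ℝ H) (supportFunction K) l f (f - a) ≠ ⊤ := by
      simp [tikhonov, ha.supportFunction_residual hl]
    have hzero : ENNReal.ofReal (l / 2 * ‖u - (f - a)‖ ^ 2) ≤ 0 :=
      ENNReal.le_of_add_le_add_left hfinite (by simpa using (hgrowth u).trans (hu _))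
    have hnorm : l / 2 * ‖u - (f - a)‖ ^ 2 = 0 :=
      le_antisymm (ENNReal.ofReal_eq_zero.1 (le_zero_iff.1 hzero)) (by positivity)
    simpa [hl.ne', sub_eq_zero] using hnorm
  · rintro rfl w
    exact le_self_add.trans (hgrowth w)

end SupportFunction

section AdditiveProjections

variable {H : Type*} [NormedAddCommGroup H] [InnerProductSpace ℝ H] {K : Set H} {s t : ℝ}
  {y a b : H}

/-- The metric projection of `t • K` onto `s • K` realizes the Minkowski decomposition
`t • K = s • K + (t - s) • K` for all `0 < s < t`. -/
def HasAdditiveProjections (K : Set H) : Prop :=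
  ∀ ⦃s t : ℝ⦄, 0 < s → s < t → ∀ ⦃b a : H⦄, b ∈ t • K → IsProjection (s • K) b a →
    b - a ∈ (t - s) • K

theorem HasAdditiveProjections.isProjection_trans (hK : HasAdditiveProjections K)
    (hconv : Convex ℝ K) (hs : 0 < s) (hst : s < t) (hb : IsProjection (t • K) y b)
    (ha : IsProjection (s • K) b a) : IsProjection (s • K) y a := by
  refine ⟨ha.1, fun p hp => ?_⟩
  have hshift : p + (b - a) ∈ t • K := by
    rw [← add_sub_cancel s t, hconv.add_smul hs.le (sub_nonneg.2 hst.le)]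
    exact add_mem_add hp (hK hs hst hb.1 ha)
  have hyb : ⟪y - b, p - a⟫ ≤ 0 := by
    convert hb.2 _ hshift using 2
    abel
  rw [← sub_add_sub_cancel y b a, inner_add_left]
  exact add_nonpos hyb (ha.2 p hp)

theorem HasAdditiveProjections.isProjection_of_le [CompleteSpace H] (hK : HasAdditiveProjections K)
    (hcl : IsClosed K) (hconv : Convex ℝ K) (hs : 0 < s) (hst : s ≤ t)
    (ha : IsProjection (s • K) y a) (hb : IsProjection (t • K) y b) :
    IsProjection (s • K) b a := by
  rcases hst.eq_or_lt with rfl | hlt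
  · rw [hb.eq ha]
    exact isProjection_self ha.1
  · obtain ⟨a', ha'⟩ := exists_isProjection ⟨a, ha.1⟩ (hcl.smul_of_ne_zero hs.ne')
      (hconv.smul s) b
    rwa [ha.eq (hK.isProjection_trans hconv hs hlt hb ha')]

end AdditiveProjections

section Decomposition

theorem iterate_succ {X : Type*} [NormedAddCommGroup X] (u : ℕ → X) (n : ℕ) :
    iterate u (n + 1) = iterate u n + u (n + 1) :=
  Finset.sum_range_succ _ _

theorem existsUnique_forall_iterate_eq {X : Type*} [NormedAddCommGroup X] (x : ℕ → X) :
    ∃! u : ℕ → X, ∀ n, iterate u n = x n := by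
  refine ⟨fun n => n.casesOn (x 0) fun k => x (k + 1) - x k, fun n => ?_, fun u hu => ?_⟩
  · induction n with
    | zero => simp [iterate]
    | succ n ih => rw [iterate_succ, ih, add_sub_cancel]
  · funext n
    cases n with
    | zero => simpa [iterate] using hu 0
    | succ n => exact eq_sub_of_add_eq' (by rw [← hu n, ← iterate_succ, hu])

variable {H : Type*} [NormedAddCommGroup H] [InnerProductSpace ℝ H] [CompleteSpace H] {K : Set H}
  {y : H} {lam : ℕ → ℝ} {a : ℕ → H}

theorem HasAdditiveProjections.isDecomposition_iff (hK : HasAdditiveProjections K)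
    (hcl : IsClosed K) (hconv : Convex ℝ K) (h0 : 0 ∈ K) (hpos : ∀ n, 0 < lam n)
    (hmono : Monotone lam) (ha : ∀ n, IsProjection ((lam n)⁻¹ • K) y (a n)) (u : ℕ → H) :
    IsDecomposition (ContinuousLinearMap.id ℝ H) (supportFunction K) lam y u ↔
      ∀ n, iterate u n = y - a n := by
  have hzero : IsTikhonovMinimizer (ContinuousLinearMap.id ℝ H) (supportFunction K) (lam 0) y
      (u 0) ↔ iterate u 0 = y - a 0 := by
    simpa [iterate] using (ha 0).isTikhonovMinimizer_iff (hpos 0) h0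
  have hsucc (n : ℕ) (hn : iterate u n = y - a n) :
      IsTikhonovMinimizer (ContinuousLinearMap.id ℝ H) (supportFunction K) (lam (n + 1))
        (y - iterate u n) (u (n + 1)) ↔ iterate u (n + 1) = y - a (n + 1) := by
    have hproj : IsProjection ((lam (n + 1))⁻¹ • K) (a n) (a (n + 1)) :=
      hK.isProjection_of_le hcl hconv (inv_pos.2 (hpos _))
        (inv_anti₀ (hpos n) (hmono n.le_succ)) (ha (n + 1)) (ha n)
    rw [hn, sub_sub_cancel, hproj.isTikhonovMinimizer_iff (hpos _) h0, iterate_succ, hn,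
      ← sub_add_sub_cancel y (a n) (a (n + 1)), add_right_inj]
  refine ⟨fun h n => ?_, fun h => ⟨hzero.2 (h 0), fun n => (hsucc n (h n)).2 (h (n + 1))⟩⟩
  induction n with
  | zero => exact hzero.1 h.zero
  | succ n ih => exact (hsucc n ih).1 (h.succ n)

end Decomposition

section Potential

/-- The truncation of `x` to the interval `[-c, c]`. -/
def clip (c x : ℝ) : ℝ := max (-c) (min c x)

theorem abs_clip_le {c : ℝ} (hc : 0 ≤ c) (x : ℝ) : |clip c x| ≤ c :=
  abs_le.2 ⟨le_max_left _ _, max_le (neg_le_self hc) (min_le_left _ _)⟩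

theorem abs_sub_clip_sub_le {r t x y : ℝ} (hrt : r ≤ t) (hx : |x| ≤ t) (hy : |y| ≤ r) :
    |x - clip (t - r) (x - y)| ≤ r := by
  rw [abs_le] at *
  grind [clip]

variable {H ι : Type*} [NormedAddCommGroup H] [InnerProductSpace ℝ H] {V : Submodule ℝ H}
  {P : ι → H →L[ℝ] ℝ}

/-- The vectors of `V` whose potentials are bounded by `r`; here `P i p` is the value at `i` of the
potential of `p`. -/
def potentialBall (V : Submodule ℝ H) (P : ι → H →L[ℝ] ℝ) (r : ℝ) : Set H :=
  {p | p ∈ V ∧ ∀ i, |P i p| ≤ r}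

/-- Truncating the potential of a vector `p` of `V` gives the potential of a vector `q` of `V`, and
`p` splits orthogonally into `q` and the part that has been cut off. This is the contraction
property of Dirichlet forms, strengthened by locality. -/
def AdmitsClipping (V : Submodule ℝ H) (P : ι → H →L[ℝ] ℝ) : Prop :=
  ∀ p ∈ V, ∀ c > 0, ∃ q ∈ V, (∀ i, P i q = clip c (P i p)) ∧ ⟪p - q, q⟫ = 0

theorem zero_mem_potentialBall {r : ℝ} (hr : 0 ≤ r) : 0 ∈ potentialBall V P r :=
  ⟨V.zero_mem, fun i => by simpa using hr⟩

theorem isClosed_potentialBall (hV : IsClosed (V : Set H)) (r : ℝ) :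
    IsClosed (potentialBall V P r) := by
  simp only [potentialBall, ofPred_and, ofPred_forall]
  exact hV.inter (isClosed_iInter fun i => isClosed_le (P i).continuous.abs continuous_const)

theorem convex_potentialBall (r : ℝ) : Convex ℝ (potentialBall V P r) := by
  have hball : potentialBall V P r = (V : Set H) ∩ ⋂ i, P i ⁻¹' Icc (-r) r := by
    ext p
    simp [potentialBall, abs_le]
  rw [hball]
  exact V.convex.inter (convex_iInter fun i => (convex_Icc (-r) r).is_linear_preimage
    (P i).isLinear)

theorem smul_potentialBall {c : ℝ} (hc : 0 < c) (r : ℝ) :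
    c • potentialBall V P r = potentialBall V P (c * r) := by
  ext p
  simp [mem_smul_set_iff_inv_smul_mem₀ hc.ne', potentialBall, V.smul_mem_iff (inv_ne_zero hc.ne'),
    abs_mul, abs_of_pos hc, inv_mul_le_iff₀ hc]

theorem AdmitsClipping.hasAdditiveProjections (hP : AdmitsClipping V P) :
    HasAdditiveProjections (potentialBall V P 1) := by
  intro s t hs hst b a hb ha
  rw [smul_potentialBall (hs.trans hst), mul_one] at hb
  rw [smul_potentialBall hs, mul_one] at ha
  rw [smul_potentialBall (sub_pos.2 hst), mul_one]
  have hab : b - a ∈ V := V.sub_mem hb.1 ha.1.1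
  obtain ⟨q, hqV, hq, horth⟩ := hP (b - a) hab (t - s) (sub_pos.2 hst)
  have hbq : b - q ∈ potentialBall V P s := by
    refine ⟨V.sub_mem hb.1 hqV, fun i => ?_⟩
    rw [map_sub, hq, map_sub]
    exact abs_sub_clip_sub_le hst.le (hb.2 i) (ha.1.2 i)
  have hle : ⟪b - a - q, b - a - q⟫ ≤ 0 := by
    rw [inner_sub_right, horth, sub_zero, real_inner_comm, sub_right_comm]
    exact ha.2 _ hbq
  have hq_eq : b - a = q := sub_eq_zero.1 (real_inner_self_nonpos.1 hle)
  refine ⟨hab, fun i => ?_⟩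
  rw [hq_eq, hq]
  exact abs_clip_le (sub_nonneg.2 hst.le) _

end Potential

section Clipping

open Filter Topology

theorem lipschitzWith_clip (c : ℝ) : LipschitzWith 1 (clip c) :=
  (LipschitzWith.id.const_min c).const_max (-c)

theorem absolutelyContinuousOnInterval_lipschitzWith_comp {X Y : Type*} [PseudoMetricSpace X]
    [PseudoMetricSpace Y] {C : NNReal} {g : X → Y} {f : ℝ → X} {a b : ℝ} (hg : LipschitzWith C g)
    (hf : AbsolutelyContinuousOnInterval f a b) : AbsolutelyContinuousOnInterval (g ∘ f) a b := by
  refine squeeze_zero (fun _ => Finset.sum_nonneg fun _ _ => dist_nonneg) (fun I => ?_)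
    (by simpa using Tendsto.const_mul (C : ℝ) hf)
  rw [Finset.mul_sum]
  exact Finset.sum_le_sum fun _ _ => hg.dist_le_mul _ _

theorem deriv_clip_comp_eq_or_eq_zero {f : ℝ → ℝ} {c f' x : ℝ} (hf : HasDerivAt f f' x) :
    deriv (clip c ∘ f) x = f' ∨ deriv (clip c ∘ f) x = 0 := by
  by_cases hupper : c ≤ f x
  · have hmax : IsLocalMax (clip c ∘ f) x :=
      Eventually.of_forall fun z => max_le_max_left _ (by simp [hupper])
    exact Or.inr hmax.deriv_eq_zero
  by_cases hlower : f x ≤ -c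
  · have hmin : IsLocalMin (clip c ∘ f) x :=
      Eventually.of_forall fun z => by simp [clip, hlower]
    exact Or.inr hmin.deriv_eq_zero
  have hinside : clip c ∘ f =ᶠ[𝓝 x] f := by
    filter_upwards [hf.continuousAt.eventually (Ioo_mem_nhds (not_le.1 hlower) (not_le.1 hupper))]
      with z hz
    simp [clip, hz.1.le, hz.2.le]
  exact Or.inl (hinside.deriv_eq.trans hf.deriv)

end Clipping

section Primitive

/-- The value at `t` of the primitive `∫₀ᵗ p` of `p ∈ L²(0, 1)`, as a continuous linear functional
of `p`. -/
noncomputable def primitive (t : unitInterval) : L2 →L[ℝ] ℝ :=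
  innerSL ℝ (indicatorConstLp 2 (measurableSet_Ioc : MeasurableSet (Ioc 0 (t : ℝ)))
    (measure_ne_top _ _) (1 : ℝ))

theorem primitive_apply (t : unitInterval) (p : L2) :
    primitive t p = ∫ x in (0 : ℝ)..t, p x := by
  have hIoc : (Ioc 0 (t : ℝ) ∩ Ioo 0 1 : Set ℝ) =ᵐ[volume] Ioc 0 (t : ℝ) := by
    have hsub : Ioc 0 (t : ℝ) ⊆ Ioc 0 1 := Ioc_subset_Ioc_right t.2.2
    conv_rhs => rw [← inter_eq_left.2 hsub]
    exact ae_eq_set_inter (ae_eq_refl _) Ioo_ae_eq_Ioc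
  rw [primitive, innerSL_apply_apply, L2.inner_indicatorConstLp_one,
    Measure.restrict_restrict measurableSet_Ioc, intervalIntegral.integral_of_le t.2.1]
  exact setIntegral_congr_set hIoc

theorem primitive_toLp (t : unitInterval) {f : ℝ → ℝ}
    (hf : MemLp f 2 (volume.restrict (Ioo (0 : ℝ) 1))) :
    primitive t (hf.toLp f) = ∫ x in (0 : ℝ)..t, f x := by
  rw [primitive_apply]
  refine intervalIntegral.integral_congr_ae_restrict ?_
  rw [uIoc_of_le t.2.1, Filter.EventuallyEq, ← Measure.restrict_congr_set Ioo_ae_eq_Ioc]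
  exact ae_restrict_of_ae_restrict_of_subset (Ioo_subset_Ioo_right t.2.2) hf.coeFn_toLp

theorem abs_primitive_le (t : unitInterval) (p : L2) : |primitive t p| ≤ ‖p‖ := by
  rw [primitive, innerSL_apply_apply]
  refine (abs_real_inner_le_norm _ _).trans (mul_le_of_le_one_left (norm_nonneg _) ?_)
  refine norm_indicatorConstLp_le.trans ?_
  rw [norm_one, one_mul]
  refine Real.rpow_le_one measureReal_nonneg ?_ (by positivity)
  exact (measureReal_mono (subset_univ _)).trans (by simp)

theorem intervalIntegrable_L2 (p : L2) : IntervalIntegrable p volume 0 1 := by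
  rw [intervalIntegrable_iff_integrableOn_Ioo_of_le zero_le_one]
  exact (Lp.memLp p).integrable one_le_two

theorem absolutelyContinuousOnInterval_clip_integral (c : ℝ) (p : L2) :
    AbsolutelyContinuousOnInterval (clip c ∘ fun t => ∫ x in (0 : ℝ)..t, p x) 0 1 :=
  absolutelyContinuousOnInterval_lipschitzWith_comp (lipschitzWith_clip c)
    ((intervalIntegrable_L2 p).absolutelyContinuousOnInterval_intervalIntegral (by simp))

theorem ae_deriv_clip_integral (c : ℝ) (p : L2) :
    ∀ᵐ x ∂(volume.restrict (Ioo (0 : ℝ) 1)),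
      deriv (clip c ∘ fun t => ∫ x in (0 : ℝ)..t, p x) x = p x ∨
        deriv (clip c ∘ fun t => ∫ x in (0 : ℝ)..t, p x) x = 0 := by
  rw [ae_restrict_iff' measurableSet_Ioo]
  filter_upwards [(intervalIntegrable_L2 p).ae_hasDerivAt_integral] with x hderiv hx
  have hx' : x ∈ uIcc (0 : ℝ) 1 := Ioo_subset_Icc_self.trans Icc_subset_uIcc hx
  exact deriv_clip_comp_eq_or_eq_zero (hderiv hx' 0 left_mem_uIcc)

theorem exists_primitive_eq_clip (p : L2) {c : ℝ} (hc : 0 ≤ c) :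
    ∃ q : L2, (∀ t, primitive t q = clip c (primitive t p)) ∧ ⟪p - q, q⟫ = 0 := by
  set g : ℝ → ℝ := clip c ∘ fun t => ∫ x in (0 : ℝ)..t, p x
  have hderiv : ∀ᵐ x ∂(volume.restrict (Ioo (0 : ℝ) 1)), deriv g x = p x ∨ deriv g x = 0 :=
    ae_deriv_clip_integral c p
  have hmem : MemLp (deriv g) 2 (volume.restrict (Ioo (0 : ℝ) 1)) := by
    refine (Lp.memLp p).mono (measurable_deriv g).aestronglyMeasurable ?_
    filter_upwards [hderiv] with x hx
    rcases hx with hx | hx <;> simp [hx]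
  refine ⟨hmem.toLp (deriv g), fun t => ?_, ?_⟩
  · have hsub : uIcc (0 : ℝ) t ⊆ uIcc 0 1 :=
      uIcc_subset_uIcc_left (Icc_subset_uIcc t.2)
    rw [primitive_toLp, ((absolutelyContinuousOnInterval_clip_integral c p).mono
      hsub).integral_deriv_eq_sub, primitive_apply]
    simp [clip, hc]
  · rw [L2.inner_def]
    refine integral_eq_zero_of_ae ?_
    filter_upwards [hderiv, hmem.coeFn_toLp, Lp.coeFn_sub p (hmem.toLp (deriv g))]
      with x hx hq hsub
    rw [hsub, Pi.sub_apply, hq]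
    rcases hx with hx | hx <;> simp [hx]

theorem admitsClipping_primitive :
    AdmitsClipping (LinearMap.ker (primitive 1).toLinearMap) primitive := by
  intro p hp c hc
  obtain ⟨q, hq, horth⟩ := exists_primitive_eq_clip p hc.le
  refine ⟨q, ?_, hq, horth⟩
  rw [LinearMap.mem_ker, ContinuousLinearMap.coe_coe] at *
  rw [hq, hp]
  simp [clip, hc.le]

end Primitive

section TestFunctions

open scoped Distributions LineDeriv
open TopologicalSpace (Opens)

variable {E F : Type*} [NormedAddCommGroup E] [NormedSpace ℝ E] [MeasurableSpace E] {Ω : Opens E}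
  {μ : Measure E} [NormedAddCommGroup F] [NormedSpace ℝ F]

/-- The map sending a test function to its class in `Lᵖ`. -/
noncomputable def testFunctionToLp [OpensMeasurableSpace E] (Ω : Opens E) (p : ℝ≥0∞)
    (μ : Measure E) [IsFiniteMeasureOnCompacts μ] : 𝓓(Ω, F) →ₗ[ℝ] Lp F p μ where
  toFun φ := (φ.continuous.memLp_of_hasCompactSupport φ.hasCompactSupport).toLp φ
  map_add' _ _ := rfl
  map_smul' _ _ := rfl

theorem coeFn_testFunctionToLp [OpensMeasurableSpace E] [IsFiniteMeasureOnCompacts μ]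
    {p : ℝ≥0∞} (φ : 𝓓(Ω, F)) : testFunctionToLp Ω p μ φ =ᵐ[μ] φ :=
  (φ.continuous.memLp_of_hasCompactSupport φ.hasCompactSupport).coeFn_toLp

theorem inner_testFunctionToLp [OpensMeasurableSpace E] [IsFiniteMeasureOnCompacts μ]
    (φ : 𝓓(Ω, ℝ)) (u : Lp ℝ 2 μ) :
    ⟪testFunctionToLp Ω 2 μ φ, u⟫ = ∫ x, u x * φ x ∂μ := by
  rw [L2.inner_def]
  refine integral_congr_ae ?_
  filter_upwards [coeFn_testFunctionToLp (p := 2) (μ := μ) φ] with x hx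
  rw [hx]
  rfl

theorem denseRange_testFunctionToLp [FiniteDimensional ℝ E] [BorelSpace E] (Ω : Opens E)
    (μ : Measure E) [IsFiniteMeasureOnCompacts μ] :
    DenseRange (testFunctionToLp Ω 2 (μ.restrict Ω) : 𝓓(Ω, ℝ) → Lp ℝ 2 (μ.restrict Ω)) := by
  rw [DenseRange, ← LinearMap.coe_range, Submodule.dense_iff_topologicalClosure_eq_top,
    Submodule.topologicalClosure_eq_top_iff, Submodule.eq_bot_iff]
  intro u hu
  have hint : LocallyIntegrableOn u Ω μ := locallyIntegrableOn_of_locallyIntegrable_restrict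
    ((Lp.memLp u).locallyIntegrable one_le_two)
  rw [Lp.eq_zero_iff_ae_eq_zero]
  refine (ae_restrict_iff' Ω.isOpen.measurableSet).2
    (Ω.isOpen.ae_eq_zero_of_integral_contDiff_smul_eq_zero hint fun g hg hcomp hsupp => ?_)
  have hzero := hu _ ⟨⟨g, hg, hcomp, hsupp⟩, rfl⟩
  rw [inner_testFunctionToLp] at hzero
  rw [← hzero, ← setIntegral_eq_integral_of_forall_compl_eq_zero (s := Ω)]
  · simp only [smul_eq_mul, mul_comm, TestFunction.coe_mk]
  · intro x hx
    rw [image_eq_zero_of_notMem_tsupport fun hx' => hx (hsupp hx'), zero_smul]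

theorem lineDerivOp_one_apply {Ω : Opens ℝ} (φ : 𝓓(Ω, F)) (x : ℝ) :
    ∂_{(1 : ℝ)} φ x = deriv φ x := by
  have hdiff : DifferentiableAt ℝ φ x := φ.contDiff.contDiffAt.differentiableAt (by simp)
  rw [TestFunction.lineDerivOp_eq_lineDerivCLM (𝕜 := ℝ),
    TestFunction.lineDerivCLM_apply_of_le (by simp), hdiff.lineDeriv_eq_fderiv,
    fderiv_apply_one_eq_deriv]

theorem exists_testFunction_integral_eq_one [FiniteDimensional ℝ E] [BorelSpace E] (μ : Measure E)
    [IsLocallyFiniteMeasure μ] [μ.IsOpenPosMeasure] (hΩ : (Ω : Set E).Nonempty) :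
    ∃ φ : 𝓓(Ω, ℝ), ∫ x, φ x ∂μ = 1 := by
  obtain ⟨c, hc⟩ := hΩ
  obtain ⟨r, hr, hball⟩ := Metric.nhds_basis_closedBall.mem_iff.1 (Ω.isOpen.mem_nhds hc)
  let ρ : ContDiffBump c := ⟨r / 2, r, half_pos hr, half_lt_self hr⟩
  exact ⟨⟨ρ.normed μ, ρ.contDiff_normed, ρ.hasCompactSupport_normed,
    ρ.tsupport_normed_eq.trans_subset hball⟩, ρ.integral_normed⟩

theorem hasDerivAt_setIntegral_Iic [CompleteSpace F] {h : ℝ → F} (hint : Integrable h)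
    (hcont : Continuous h) (t : ℝ) :
    HasDerivAt (fun t => ∫ x in Iic t, h x) (h t) t := by
  have hsplit : (fun t => ∫ x in Iic t, h x) =
      fun t => (∫ x in Iic 0, h x) + ∫ x in (0 : ℝ)..t, h x := by
    funext t
    rw [← intervalIntegral.integral_Iic_sub_Iic hint.integrableOn hint.integrableOn,
      add_sub_cancel]
  rw [hsplit]
  exact (hcont.integral_hasStrictDerivAt 0 t).hasDerivAt.const_add _

theorem exists_subset_Icc_subset_of_isCompact {α : Type*} [LinearOrder α] [TopologicalSpace α]
    [OrderClosedTopology α] {s K : Set α} (hs : s.OrdConnected) (hK : IsCompact K)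
    (hne : K.Nonempty) (hKs : K ⊆ s) : ∃ a b, K ⊆ Icc a b ∧ Icc a b ⊆ s := by
  obtain ⟨a, ha⟩ := hK.exists_isLeast hne
  obtain ⟨b, hb⟩ := hK.exists_isGreatest hne
  exact ⟨a, b, fun x hx => ⟨ha.2 hx, hb.2 hx⟩, hs.out (hKs ha.1) (hKs hb.1)⟩

theorem setIntegral_Iic_eq_zero_of_notMem_Icc {h : ℝ → F} {a b t : ℝ}
    (hsupp : Function.support h ⊆ Icc a b) (hmean : ∫ x, h x = 0) (ht : t ∉ Icc a b) :
    ∫ x in Iic t, h x = 0 := by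
  have hzero {x : ℝ} (hx : x ∉ Icc a b) : h x = 0 :=
    Function.notMem_support.1 fun h' => hx (hsupp h')
  rcases lt_or_ge t a with hta | hat
  · exact setIntegral_eq_zero_of_forall_eq_zero fun x hx =>
      hzero fun hx' => (hx'.1.trans hx).not_gt hta
  · rw [setIntegral_eq_integral_of_forall_compl_eq_zero, hmean]
    exact fun x hx => hzero fun hx' => ht ⟨hat, (not_le.1 hx).le.trans hx'.2⟩

theorem exists_lineDerivOp_one_eq [CompleteSpace F] {Ω : Opens ℝ}
    (hΩ : (Ω : Set ℝ).OrdConnected) (h : 𝓓(Ω, F)) (hmean : ∫ x, h x = 0) :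
    ∃ φ : 𝓓(Ω, F), ∂_{(1 : ℝ)} φ = h := by
  rcases (tsupport h).eq_empty_or_nonempty with hempty | hne
  · have hzero : h = 0 := by
      ext x
      simp [image_eq_zero_of_notMem_tsupport, hempty]
    exact ⟨0, by simp [hzero]⟩
  obtain ⟨a, b, hsupp, hab⟩ := exists_subset_Icc_subset_of_isCompact hΩ
    h.hasCompactSupport.isCompact hne h.tsupport_subset
  have hderiv := hasDerivAt_setIntegral_Iic
    (h.continuous.integrable_of_hasCompactSupport h.hasCompactSupport) h.continuous
  have hderiv_eq : deriv (fun t => ∫ x in Iic t, h x) = h := funext fun t => (hderiv t).deriv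
  have hvanish (t : ℝ) (ht : t ∉ Icc a b) : ∫ x in Iic t, h x = 0 :=
    setIntegral_Iic_eq_zero_of_notMem_Icc ((subset_tsupport h).trans hsupp) hmean ht
  let φ : 𝓓(Ω, F) :=
    { toFun := fun t => ∫ x in Iic t, h x
      contDiff' := contDiff_infty_iff_deriv.2
        ⟨fun t => (hderiv t).differentiableAt, hderiv_eq.symm ▸ h.contDiff⟩
      hasCompactSupport' := HasCompactSupport.intro isCompact_Icc hvanish
      tsupport_subset' := (closure_minimal (Function.support_subset_iff'.2 hvanish)
        isClosed_Icc).trans hab }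
  exact ⟨φ, TestFunction.ext fun x => (lineDerivOp_one_apply φ x).trans (hderiv x).deriv⟩

end TestFunctions

section TotalVariation

open scoped Distributions LineDeriv
open TopologicalSpace (Opens)

/-- The open unit interval, on which the test functions are supported. -/
def openUnitInterval : Opens ℝ := ⟨Ioo 0 1, isOpen_Ioo⟩

/-- The class of a test function in `L²(0, 1)`. -/
noncomputable def toL2 : 𝓓(openUnitInterval, ℝ) →ₗ[ℝ] L2 :=
  testFunctionToLp openUnitInterval 2 _

theorem apply_eq_zero_of_notMem_Ioo (φ : 𝓓(openUnitInterval, ℝ)) {x : ℝ} (hx : x ∉ Ioo 0 1) :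
    φ x = 0 :=
  image_eq_zero_of_notMem_tsupport fun h => hx (φ.tsupport_subset h)

theorem primitive_toL2 (t : unitInterval) (φ : 𝓓(openUnitInterval, ℝ)) :
    primitive t (toL2 φ) = ∫ x in (0 : ℝ)..t, φ x :=
  primitive_toLp t (φ.continuous.memLp_of_hasCompactSupport φ.hasCompactSupport)

theorem primitive_one_toL2 (φ : 𝓓(openUnitInterval, ℝ)) : primitive 1 (toL2 φ) = ∫ x, φ x := by
  have hsupp : Function.support φ ⊆ Ioc 0 1 :=
    (subset_tsupport φ).trans (φ.tsupport_subset.trans Ioo_subset_Ioc_self)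
  rw [primitive_toL2, Icc.coe_one,
    intervalIntegral.integral_eq_integral_of_support_subset hsupp]

theorem primitive_toL2_lineDerivOp (t : unitInterval) (φ : 𝓓(openUnitInterval, ℝ)) :
    primitive t (toL2 (∂_{(1 : ℝ)} φ)) = φ t := by
  simp only [primitive_toL2, lineDerivOp_one_apply]
  rw [intervalIntegral.integral_deriv_eq_sub
      (fun x _ => φ.contDiff.contDiffAt.differentiableAt (by simp))
      ((φ.contDiff.continuous_deriv (by simp)).intervalIntegrable _ _),
    apply_eq_zero_of_notMem_Ioo φ left_notMem_Ioo, sub_zero]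

/-- The derivatives of the admissible test functions in the definition of the total variation. -/
def testDerivatives : Set L2 :=
  {p | ∃ φ : 𝓓(openUnitInterval, ℝ), (∀ x, |φ x| ≤ 1) ∧ toL2 (∂_{(1 : ℝ)} φ) = p}

/-- The derivatives in `L²(0, 1)` of the functions that are bounded by one and vanish at both
endpoints. -/
def dualUnitBall : Set L2 :=
  potentialBall (LinearMap.ker (primitive 1).toLinearMap) primitive 1

theorem isClosed_dualUnitBall : IsClosed dualUnitBall :=
  isClosed_potentialBall (primitive 1).isClosed_ker 1

theorem testDerivatives_subset_dualUnitBall : testDerivatives ⊆ dualUnitBall := by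
  rintro _ ⟨φ, hφ, rfl⟩
  refine ⟨?_, fun t => by simpa only [primitive_toL2_lineDerivOp] using hφ t⟩
  rw [LinearMap.mem_ker, ContinuousLinearMap.coe_coe, primitive_toL2_lineDerivOp]
  exact apply_eq_zero_of_notMem_Ioo φ right_notMem_Ioo

theorem inv_smul_toL2_mem_testDerivatives {h : 𝓓(openUnitInterval, ℝ)} {c : ℝ} (hc : 0 < c)
    (hmean : primitive 1 (toL2 h) = 0) (hbound : ∀ t, |primitive t (toL2 h)| ≤ c) :
    c⁻¹ • toL2 h ∈ testDerivatives := by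
  rw [primitive_one_toL2] at hmean
  obtain ⟨φ, rfl⟩ := exists_lineDerivOp_one_eq ordConnected_Ioo h hmean
  refine ⟨c⁻¹ • φ, fun x => ?_, by rw [LineDeriv.lineDerivOp_smul, map_smul]⟩
  suffices |φ x| ≤ c by
    rwa [smul_apply, smul_eq_mul, abs_mul, abs_inv, abs_of_pos hc,
      inv_mul_le_iff₀ hc, mul_one]
  by_cases hx : x ∈ Ioo 0 1
  · simpa only [primitive_toL2_lineDerivOp] using hbound ⟨x, Ioo_subset_Icc_self hx⟩
  · rw [apply_eq_zero_of_notMem_Ioo φ hx, abs_zero]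
    exact hc.le

theorem dualUnitBall_subset_closure_testDerivatives :
    dualUnitBall ⊆ closure testDerivatives := by
  intro p hp
  obtain ⟨ρ, hρ⟩ := exists_testFunction_integral_eq_one (Ω := openUnitInterval) volume
    (nonempty_Ioo.2 one_pos)
  -- Correcting `g` to mean zero and rescaling depend continuously on `g` and fix `p`.
  let P : L2 → L2 := fun g => g - primitive 1 g • toL2 ρ
  let R : L2 → L2 := fun g => (1 + ‖P g - p‖)⁻¹ • P g
  have hP : Continuous P := by fun_prop
  have hR : Continuous R :=
    ((continuous_const.add (hP.sub continuous_const).norm).inv₀ fun g =>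
      (add_pos_of_pos_of_nonneg one_pos (norm_nonneg _)).ne').smul hP
  have hRp : R p = p := by
    have hPp : P p = p := by simp [P, show primitive 1 p = 0 from hp.1]
    simp [R, hPp]
  rw [← hRp]
  refine map_mem_closure hR (denseRange_testFunctionToLp openUnitInterval volume p) ?_
  rintro _ ⟨g, rfl⟩
  have hPg : P (toL2 g) = toL2 (g - primitive 1 (toL2 g) • ρ) := by
    rw [map_sub, map_smul]
  have hmean : primitive 1 (P (toL2 g)) = 0 := by
    simp [P, primitive_one_toL2 ρ, hρ]
  have hbound (t : unitInterval) : |primitive t (P (toL2 g))| ≤ 1 + ‖P (toL2 g) - p‖ := by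
    rw [← sub_add_cancel (primitive t (P (toL2 g))) (primitive t p), add_comm, ← map_sub]
    exact (abs_add_le _ _).trans (add_le_add (hp.2 t) (abs_primitive_le t _))
  change (1 + ‖P (toL2 g) - p‖)⁻¹ • P (toL2 g) ∈ testDerivatives
  rw [hPg] at *
  exact inv_smul_toL2_mem_testDerivatives (by positivity) hmean hbound

theorem closure_testDerivatives : closure testDerivatives = dualUnitBall :=
  (closure_minimal testDerivatives_subset_dualUnitBall isClosed_dualUnitBall).antisymm
    dualUnitBall_subset_closure_testDerivatives

theorem inner_toL2_lineDerivOp (φ : 𝓓(openUnitInterval, ℝ)) (u : L2) :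
    ⟪toL2 (∂_{(1 : ℝ)} φ), u⟫ = ∫ x in Ioo (0 : ℝ) 1, u x * deriv φ x := by
  simp only [toL2, inner_testFunctionToLp, lineDerivOp_one_apply]

theorem totalVariation_eq_supportFunction : totalVariation = supportFunction dualUnitBall := by
  rw [← closure_testDerivatives, supportFunction_closure]
  funext u
  refine le_antisymm (iSup_le ?_) (iSup₂_le ?_)
  · rintro ⟨φ, hsmooth, hcomp, hsupp, hbound⟩
    let ψ : 𝓓(openUnitInterval, ℝ) := ⟨φ, hsmooth, hcomp, hsupp⟩
    rw [show (∫ x in Ioo (0 : ℝ) 1, u x * deriv φ x) = ⟪toL2 (∂_{(1 : ℝ)} ψ), u⟫ from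
      (inner_toL2_lineDerivOp ψ u).symm]
    exact ofReal_inner_le_supportFunction (K := testDerivatives) ⟨ψ, hbound, rfl⟩ u
  · rintro _ ⟨φ, hbound, rfl⟩
    rw [inner_toL2_lineDerivOp]
    exact le_iSup (fun ψ : {ψ : ℝ → ℝ // IsTestFunction ψ} =>
      ENNReal.ofReal (∫ x in Ioo (0 : ℝ) 1, u x * deriv ψ.1 x))
      ⟨φ, φ.contDiff, φ.hasCompactSupport, φ.tsupport_subset, hbound⟩

end TotalVariation

end MHDM

theorem mainTheorem7_general {H : Type*} [NormedAddCommGroup H] [InnerProductSpace ℝ H]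
    [CompleteSpace H] {K : Set H} (hcl : IsClosed K) (hconv : Convex ℝ K) (h0 : 0 ∈ K)
    (hK : MHDM.HasAdditiveProjections K) (y : H) (lam : ℕ → ℝ) (hpos : ∀ n, 0 < lam n)
    (hmono : Monotone lam) :
    (∀ n, ∃! x : H, MHDM.IsTikhonovMinimizer (ContinuousLinearMap.id ℝ H)
        (MHDM.supportFunction K) (lam n) y x) ∧
    (∃! u : ℕ → H, MHDM.IsDecomposition (ContinuousLinearMap.id ℝ H)
        (MHDM.supportFunction K) lam y u) ∧
    ∀ (u : ℕ → H) (x : ℕ → H),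
      MHDM.IsDecomposition (ContinuousLinearMap.id ℝ H) (MHDM.supportFunction K) lam y u →
      (∀ n, MHDM.IsTikhonovMinimizer (ContinuousLinearMap.id ℝ H)
        (MHDM.supportFunction K) (lam n) y (x n)) →
      ∀ n, MHDM.iterate u n = x n := by
  choose a ha using fun n => MHDM.exists_isProjection (Nonempty.smul_set (a := (lam n)⁻¹) ⟨0, h0⟩)
    (hcl.smul_of_ne_zero (inv_ne_zero (hpos n).ne')) (hconv.smul (lam n)⁻¹) y
  have hmin (n : ℕ) (x : H) := (ha n).isTikhonovMinimizer_iff (u := x) (hpos n) h0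
  have hdec := hK.isDecomposition_iff hcl hconv h0 hpos hmono ha
  refine ⟨fun n => ?_, ?_, fun u x hu hx n => ?_⟩
  · simp only [hmin, existsUnique_eq]
  · simp only [hdec, MHDM.existsUnique_forall_iterate_eq]
  · rw [(hdec u).1 hu n, (hmin n _).1 (hx n)]

theorem mainTheorem7 (y : MHDM.L2) (lam : ℕ → ℝ) (hpos : ∀ n, 0 < lam n) (hmono : Monotone lam) :
    (∀ n, ∃! x : MHDM.L2, MHDM.IsTikhonovMinimizer (ContinuousLinearMap.id ℝ MHDM.L2)
        MHDM.totalVariation (lam n) y x) ∧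
    (∃! u : ℕ → MHDM.L2, MHDM.IsDecomposition (ContinuousLinearMap.id ℝ MHDM.L2)
        MHDM.totalVariation lam y u) ∧
    ∀ (u : ℕ → MHDM.L2) (x : ℕ → MHDM.L2),
      MHDM.IsDecomposition (ContinuousLinearMap.id ℝ MHDM.L2) MHDM.totalVariation lam y u →
      (∀ n, MHDM.IsTikhonovMinimizer (ContinuousLinearMap.id ℝ MHDM.L2)
        MHDM.totalVariation (lam n) y (x n)) →
      ∀ n, MHDM.iterate u n = x n := by
  rw [MHDM.totalVariation_eq_supportFunction]
  exact mainTheorem7_general MHDM.isClosed_dualUnitBall (MHDM.convex_potentialBall 1)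
    (MHDM.zero_mem_potentialBall zero_le_one) MHDM.admitsClipping_primitive.hasAdditiveProjections
    y lam hpos hmono
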